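/- Theorem (Stable robust convex vector Farkas lemma II). Let $X, Y$ be real locally convex Hausdorff topological vector spaces, $Z$ a real normed space, and $\mathcal U$ a nonempty compact topological space. Let $K\subsetneq Y$ be a closed convex cone with $\operatorname{int}K\neq\emptyset$, $S\subset Z$ a nonempty closed convex cone, and $C\subset X$. For a space $V$ put $V^\bullet=V\cup\{-\infty_V,+\infty_V\}$, where $(+\infty_V)+a=a+(+\infty_V)=+\infty_V$ for $a\neq-\infty_V$. Let $F\colon X\to Y^\bullet$ and $G_u\colon X\to Z^\bullet$ ($u\in\mathcal U$) be proper, i.e. they never take the value $-\infty$ and their domains are nonempty, where $\operatorname{dom}F=\{x: F(x)\ne+\infty_Y\}$ and likewise for $G_u$. Assume $A\cap\operatorname{dom}F\neq\emptyset$, where $A=\{x\in C: G_u(x)\in -S\ \ \forall u\in\mathcal U\}$. A continuous linear $T\colon Z\to W$ is extended to $Z^\bullet$ by $T(\pm\infty_Z)=\pm\infty_W$ (in particular for $W=Y$ and $W=\mathbb R$). Put $S^+=\{z^*\in Z^*: z^*(s)\ge 0\ \forall s\in S\}$, $K^+=\{y^*\in Y^*: y^*(y)\ge 0\ \forall y\in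 K\}$, $\mathcal L_+(S,K)=\{T\in\mathcal L(Z,Y): T(S)\subset K\}$ and $\mathcal L^w_+(S,K)=\{T\in\mathcal L(Z,Y): T(S)\cap(-\operatorname{int}K)=\emptyset\}$, where $\mathcal L(\cdot,\cdot)$ denotes the space of continuous linear maps. Assume: - $(\mathcal H_0)$ $C$ is nonempty, closed and convex; $\{(x,y)\in X\times Y: y\in F(x)+K\}$ is convex and $y^*\circ F$ is lower semicontinuous for every $y^*\in K^+\setminus\{0\}$; for every $u\in\mathcal U$ the set $\{(x,z)\in X\times Z: z\in G_u(x)+S\}$ is convex and closed. - $(\mathcal H_1)$ For all $z_1^*,z_2^*\in S^+$ and $u_1,u_2\in\mathcal U$ there are $z^*\in S^+$ and $u\in\mathcal U$ such that $z_1^*(G_{u_1}(x))+z_2^*(G_{u_2}(x))\le z^*(G_u(x))$ for all $x\in C\cap\operatorname{dom}F$. - $(\mathcal H_2)$ For every $x\in C\cap\operatorname{dom}F$ and every net $(z^*_\alpha,u_\alpha,r_\alpha)$ in $S^+\times\mathcal U\times\mathbb R$ with $z^*_\alpha(G_{u_\alpha}(x))\ge r_\alpha$ for all $\alpha$: if $z^*_\alpha\to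 z^*\in S^+$ weak*, $u_\alpha\to u\in\mathcal U$ and $r_\alpha\to r\in\mathbb R$, then $z^*(G_u(x))\ge r$. - $(C_0)$ For every $u\in\mathcal U$ there is $x_u\in C\cap\operatorname{dom}F$ with $G_u(x_u)\in-\operatorname{int}S$. Then for all $\mathcal V\subset\mathcal L(X,Y)$ and $\mathcal W\subset Y$ the following hold. (c) For every $(L,y)\in\mathcal V\times\mathcal W$, the assertion $(\alpha)$ for every $x\in C$ with $G_u(x)\in -S$ for all $u\in\mathcal U$, one has $y-L(x)+F(x)\notin-\operatorname{int}K$ is equivalent to $(\beta)$ there are $u\in\mathcal U$ and $T\in\mathcal L_+(S,K)$ such that $F(x)+(T\circ G_u)(x)-L(x)+y\notin-\operatorname{int}K$ for all $x\in C$. (d) For every $(L,y)\in\mathcal V\times\mathcal W$, $(\alpha)$ is equivalent to $(\gamma)$ there are $u\in\mathcal U$ and $T\in\mathcal L^w_+(S,K)$ such that $F(x)+(T\circ G_u)(x)-L(x)+y\notin -T(S)-\operatorname{int}K$ for all $x\in C$. (c$_k$) For every $k\in\operatorname{int}K$ and every $(L,y)\in\mathcal V\times\mathcal W$, $(\alpha)$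 is equivalent to $(\delta)$ there are $u\in\mathcal U$ and $z^*\in S^+$ such that $F(x)+((k\cdot z^*)\circ G_u)(x)-L(x)+y\notin-\operatorname{int}K$ for all $x\in C$, where $(k\cdot z^*)(z)=z^*(z)\,k$ for $z\in Z$. -/

import Mathlib

open Set Filter Topology
open scoped Pointwise

namespace RobustFarkas

universe u v w

/-- `V• = V ∪ {-∞, +∞}`. Mathlib's addition on this type satisfies
`(+∞) + a = a + (+∞) = +∞` for `a ≠ -∞` and `(-∞) + a = a + (-∞) = -∞`.
For `V = ℝ` it is the underlying type of `EReal`. -/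
abbrev Ext (V : Type u) : Type u := WithBot (WithTop V)

/-- The inclusion of `V` in `V•`. -/
def fin {V : Type u} (a : V) : Ext V := ((a : WithTop V) : WithBot (WithTop V))

/-- The greatest element `+∞` of `V•`. -/
def posInf {V : Type u} : Ext V := ((⊤ : WithTop V) : WithBot (WithTop V))

/-- The smallest element `-∞` of `V•`. -/
def negInf {V : Type u} : Ext V := (⊥ : WithBot (WithTop V))

/-- A subset of `V`, seen as a subset of `V•`. -/
def finSet {V : Type u} (s : Set V) : Set (Ext V) := fin '' s

/-- The effective domain of a mapping with values in `V•`. -/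
def dom {X : Type u} {V : Type v} (F : X → Ext V) : Set X := {x | F x ≠ posInf}

/-- Properness: nonempty domain, and the value `-∞` is not taken. -/
def IsProper {X : Type u} {V : Type v} (F : X → Ext V) : Prop :=
  (dom F).Nonempty ∧ ∀ x, F x ≠ negInf

/-- The `K`-epigraph `{(x, y) ∈ X × V : y ∈ F x + K}`. -/
def epi {X : Type u} {V : Type v} [Add V] (K : Set V) (F : X → Ext V) : Set (X × V) :=
  {p | fin p.2 ∈ {F p.1} + finSet K}

/-- Extension of a map `T : V → W` to `V• → W•`, fixing the infinite elements; the value at `x` of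
the composite mapping `T ∘ G` is `extMap T (G x)`. -/
def extMap {V : Type u} {W : Type v} (T : V → W) : Ext V → Ext W := WithBot.map (WithTop.map T)

section Cones

variable {V : Type u} [AddCommGroup V] [Module ℝ V] [TopologicalSpace V]

/-- For a continuous linear functional `φ` and `a ∈ V•`, the extended real number `φ ∘ a`. -/
def scal (φ : StrongDual ℝ V) (a : Ext V) : EReal := extMap φ a

/-- The positive dual cone `K⁺`. -/
def dualCone (K : Set V) : Set (StrongDual ℝ V) := {φ | ∀ y ∈ K, 0 ≤ φ y}

/-- `F` is positively `K`-lsc: `φ ∘ F` is lsc for every `φ ∈ K⁺ \ {0}`. -/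
def PositivelyLSC {X : Type v} [TopologicalSpace X] (K : Set V) (F : X → Ext V) : Prop :=
  ∀ φ ∈ dualCone K \ {0}, LowerSemicontinuous fun x => scal φ (F x)

variable {W : Type v} [AddCommGroup W] [Module ℝ W] [TopologicalSpace W]

/-- The cone `L₊(S, K)` of positive operators. -/
def posOps (S : Set V) (K : Set W) : Set (V →L[ℝ] W) := {T | T '' S ⊆ K}

/-- The cone `L₊ʷ(S, K)` of weakly positive operators. -/
def weakPosOps (S : Set V) (K : Set W) : Set (V →L[ℝ] W) :=
  {T | (T '' S) ∩ (-interior K) = ∅}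

/-- The family `(g ν)` of mappings `U → V•` is uniformly `S⁺`-concave. -/
def UniformlyConcave {U : Type v} {I : Type w} (S : Set V) (g : I → U → Ext V) : Prop :=
  ∀ φ₁ ∈ dualCone S, ∀ φ₂ ∈ dualCone S, ∀ u₁ u₂ : U, ∃ φ ∈ dualCone S, ∃ u : U,
    ∀ ν : I, scal φ₁ (g ν u₁) + scal φ₂ (g ν u₂) ≤ scal φ (g ν u)

/-- The mapping `g : U → V•` is `S⁺`-uniformly usc, in terms of nets; `S⁺` carries the weak*
topology. -/
def UniformlyUSC {V : Type u} [AddCommGroup V] [Module ℝ V] [TopologicalSpace V]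
    {U : Type v} [TopologicalSpace U] (S : Set V) (g : U → Ext V) : Prop :=
  ∀ (D : Type (max u v)) [Preorder D] [IsDirectedOrder D] [Nonempty D]
    (φs : D → StrongDual ℝ V) (us : D → U) (rs : D → ℝ) (φ : StrongDual ℝ V) (u : U) (r : ℝ),
    (∀ a, φs a ∈ dualCone S) → φ ∈ dualCone S →
    (∀ a, (rs a : EReal) ≤ scal (φs a) (g (us a))) →
    (∀ z : V, Tendsto (fun a => φs a z) atTop (𝓝 (φ z))) →
    Tendsto us atTop (𝓝 u) → Tendsto rs atTop (𝓝 r) →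
    (r : EReal) ≤ scal φ (g u)

/-- The directed sets in the definition of `UniformlyUSC` are large enough: the condition holds for
all nets exactly if the set of all `(φ, u, r)` with `φ ∈ S⁺` and `r ≤ φ ∘ g u` is closed relative to
`S⁺ × U × ℝ`, for the weak* topology on `S⁺`. -/
theorem uniformlyUSC_iff {V : Type u} [AddCommGroup V] [Module ℝ V] [TopologicalSpace V]
    {U : Type v} [TopologicalSpace U] (S : Set V) (g : U → Ext V) :
    UniformlyUSC S g ↔ ∀ p ∈ closure {p : WeakDual ℝ V × U × ℝ |
        WeakDual.toStrongDual p.1 ∈ dualCone S ∧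
          (p.2.2 : EReal) ≤ scal (WeakDual.toStrongDual p.1) (g p.2.1)},
      WeakDual.toStrongDual p.1 ∈ dualCone S →
        (p.2.2 : EReal) ≤ scal (WeakDual.toStrongDual p.1) (g p.2.1) := by
  constructor
  · intro h p hp hpS
    set s : Set (WeakDual ℝ V × U × ℝ) := {p | WeakDual.toStrongDual p.1 ∈ dualCone S ∧
      (p.2.2 : EReal) ≤ scal (WeakDual.toStrongDual p.1) (g p.2.1)} with hs
    let D := {N : (Set (WeakDual ℝ V × U × ℝ))ᵒᵈ // OrderDual.ofDual N ∈ 𝓝 p}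
    have : Nonempty D := ⟨⟨OrderDual.toDual univ, univ_mem⟩⟩
    have : IsDirectedOrder D := ⟨fun M N =>
      ⟨⟨OrderDual.toDual (OrderDual.ofDual M.1 ∩ OrderDual.ofDual N.1), inter_mem M.2 N.2⟩,
        (inter_subset_left : _ ∩ OrderDual.ofDual N.1 ⊆ OrderDual.ofDual M.1),
        (inter_subset_right : OrderDual.ofDual M.1 ∩ _ ⊆ OrderDual.ofDual N.1)⟩⟩
    have hx : ∀ N : D, ∃ q, q ∈ OrderDual.ofDual N.1 ∩ s :=
      fun N => mem_closure_iff_nhds.1 hp _ N.2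
    choose q hq using hx
    have hlim : Tendsto q atTop (𝓝 p) := by
      intro N hN
      exact mem_map.2 (mem_atTop_sets.2 ⟨⟨N, hN⟩, fun M hM => hM (hq M).1⟩)
    refine h D (fun N => WeakDual.toStrongDual (q N).1) (fun N => (q N).2.1) (fun N => (q N).2.2)
      _ _ _ (fun N => (hq N).2.1) hpS (fun N => (hq N).2.2) ?_ ?_ ?_
    · intro z
      exact ((WeakDual.eval_continuous z).tendsto p.1).comp (continuous_fst.tendsto p |>.comp hlim)
    · exact (continuous_snd.fst.tendsto p).comp hlim
    · exact (continuous_snd.snd.tendsto p).comp hlim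
  · intro h D _ _ _ φs us rs φ u r hφs hφ hle hz hu hr
    refine h (StrongDual.toWeakDual φ, u, r) ?_ hφ
    have h1 : Tendsto (fun a => StrongDual.toWeakDual (φs a)) atTop
        (𝓝 (StrongDual.toWeakDual φ)) :=
      tendsto_iff_forall_eval_tendsto_topDualPairing.2 hz
    exact mem_closure_of_tendsto (h1.prodMk_nhds (hu.prodMk_nhds hr))
      (Eventually.of_forall fun a => ⟨hφs a, hle a⟩)

end Cones

section Farkas

variable {X : Type*} [AddCommGroup X] [Module ℝ X] [TopologicalSpace X]
  {Y : Type*} [AddCommGroup Y] [Module ℝ Y] [TopologicalSpace Y]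
  {Z : Type*} [AddCommGroup Z] [Module ℝ Z] [TopologicalSpace Z]
  {U : Type*}

/-- The robust feasible set `A = C ∩ ⋂ u, (G u)⁻¹(-S)`. -/
def feasible (S : Set Z) (C : Set X) (G : U → X → Ext Z) : Set X :=
  C ∩ ⋂ u, G u ⁻¹' finSet (-S)

/-- (α): if `x ∈ C` and `G_u(x) ∈ -S` for all `u`, then `y - L(x) + F(x) ∉ -int K`. -/
def RobustImplication (K : Set Y) (S : Set Z) (C : Set X) (F : X → Ext Y) (G : U → X → Ext Z)
    (L : X →L[ℝ] Y) (y : Y) : Prop :=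
  ∀ x ∈ C, (∀ u, G u x ∈ finSet (-S)) → fin (y - L x) + F x ∉ finSet (-interior K)

/-- (β): multiplier in `L₊(S, K)`. -/
def HasPosMultiplier (K : Set Y) (S : Set Z) (C : Set X) (F : X → Ext Y) (G : U → X → Ext Z)
    (L : X →L[ℝ] Y) (y : Y) : Prop :=
  ∃ u : U, ∃ T ∈ posOps S K,
    ∀ x ∈ C, F x + extMap T (G u x) + fin (-L x + y) ∉ finSet (-interior K)

/-- (γ): multiplier in `L₊ʷ(S, K)`. -/
def HasWeakPosMultiplier (K : Set Y) (S : Set Z) (C : Set X) (F : X → Ext Y) (G : U → X → Ext Z)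
    (L : X →L[ℝ] Y) (y : Y) : Prop :=
  ∃ u : U, ∃ T ∈ weakPosOps S K,
    ∀ x ∈ C, F x + extMap T (G u x) + fin (-L x + y) ∉ finSet (-(T '' S) - interior K)

/-- (δ): scalar multiplier in `S⁺`, in the direction `k`. -/
def HasScalarMultiplier (K : Set Y) (S : Set Z) (C : Set X) (F : X → Ext Y) (G : U → X → Ext Z)
    (k : Y) (L : X →L[ℝ] Y) (y : Y) : Prop :=
  ∃ u : U, ∃ φ ∈ dualCone S,
    ∀ x ∈ C, F x + extMap (fun z => φ z • k) (G u x) + fin (-L x + y) ∉ finSet (-interior K)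

end Farkas

end RobustFarkas

open RobustFarkas

namespace RobustFarkas

universe u v w

/-! ### Arithmetic in `V•` -/

section Extended

variable {V : Type u} {W : Type v}

/-! The assertions form a cycle (α) ⇒ (δ) ⇒ (β) ⇒ (γ) ⇒ (α), and only the first arrow is deep. For
the others, `k · z*` is a positive operator, `int K + K ⊆ int K` makes the test in (β) the stronger
one, and at a feasible point the term `T (G_u x)` lies in `-T(S)`.

For (α) ⇒ (δ), Hahn–Banach separates `-int K` from the upward closed image of the feasible set
(`RobustImplication.exists_dualCone`). The resulting `ψ ∈ K⁺ \ {0}` makes `p = ψ ∘ (F - L + y)` a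
convex function that is nonnegative on the feasible set. Scalar robust duality (`exists_multiplier`)
then yields one `u` and one `φ ∈ S⁺` with `p + φ ∘ G_u ≥ 0` on `C ∩ dom F`. Dividing `φ` by `ψ k >
0` gives the multiplier in direction `k`: `ψ` of the vector Lagrangian is exactly `p + φ ∘ G_u`,
while `ψ < 0` on `-int K`.

The scalar duality is a compactness argument. For finitely many points and positive tolerances,
separation in a finite-dimensional space produces an approximate multiplier
(`exists_multiplier_of_finite`); convexity there comes from (H1). Pairs (multiplier, weight of `p`),
normalised at an interior point of `S`, range over a weak* compact set, and (H2) makes the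
constraints closed, so one normalised triple works for all points. The Slater condition (C0) keeps
the weight of `p` from vanishing. -/

theorem fin_injective : Function.Injective (fin : V → Ext V) :=
  fun _ _ h => WithTop.coe_injective (WithBot.coe_injective h)

theorem posInf_ne_fin (a : V) : (posInf : Ext V) ≠ fin a :=
  fun h => WithTop.top_ne_coe (WithBot.coe_injective h)

theorem negInf_ne_fin (a : V) : (negInf : Ext V) ≠ fin a := WithBot.bot_ne_coe

theorem ext_cases (a : Ext V) : a = negInf ∨ a = posInf ∨ ∃ b, a = fin b := by
  rcases a with _ | _ | a
  · exact Or.inl rfl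
  · exact Or.inr (Or.inl rfl)
  · exact Or.inr (Or.inr ⟨a, rfl⟩)

theorem fin_mem_finSet {s : Set V} {a : V} : fin a ∈ finSet s ↔ a ∈ s :=
  fin_injective.mem_set_image

theorem extMap_fin (T : V → W) (a : V) : extMap T (fin a) = fin (T a) := rfl

theorem fin_add_fin [Add V] (a b : V) : fin a + fin b = fin (a + b) := rfl

theorem add_eq_fin [Add V] {a b : Ext V} {c : V} (h : a + b = fin c) :
    ∃ a' b', a = fin a' ∧ b = fin b' ∧ a' + b' = c := by
  rcases ext_cases a with rfl | rfl | ⟨a', rfl⟩ <;> rcases ext_cases b with rfl | rfl | ⟨b', rfl⟩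
  case inr.inr.inr.inr => exact ⟨a', b', rfl, rfl, fin_injective h⟩
  all_goals first
    | exact absurd h (negInf_ne_fin c)
    | exact absurd h (posInf_ne_fin c)

theorem extMap_eq_fin {T : V → W} {a : Ext V} {c : W} (h : extMap T a = fin c) :
    ∃ b, a = fin b ∧ T b = c := by
  rcases ext_cases a with rfl | rfl | ⟨b, rfl⟩
  · exact absurd h (negInf_ne_fin c)
  · exact absurd h (posInf_ne_fin c)
  · exact ⟨b, rfl, fin_injective h⟩

theorem IsProper.eq_fin {X : Type w} {F : X → Ext V} (hF : IsProper F) {x : X} (hx : x ∈ dom F) :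
    ∃ a, F x = fin a := by
  rcases ext_cases (F x) with h | h | h
  · exact absurd h (hF.2 x)
  · exact absurd h hx
  · exact h

theorem mem_dom_of_eq_fin {X : Type w} {F : X → Ext V} {x : X} {a : V} (h : F x = fin a) :
    x ∈ dom F :=
  fun h' => posInf_ne_fin a (h'.symm.trans h)

theorem mem_epi_iff {X : Type w} [AddCommGroup V] {K : Set V} {F : X → Ext V} {x : X} {v : V} :
    (x, v) ∈ epi K F ↔ ∃ a, F x = fin a ∧ v - a ∈ K := by
  constructor
  · rintro ⟨_, rfl, _, ⟨k, hk, rfl⟩, h⟩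
    obtain ⟨a, b, ha, hb, hab⟩ := add_eq_fin h
    refine ⟨a, ha, ?_⟩
    cases fin_injective hb
    rw [← show a + k = v from hab, add_sub_cancel_left]
    exact hk
  · rintro ⟨a, ha, hv⟩
    refine ⟨_, rfl, _, ⟨_, hv, rfl⟩, ?_⟩
    change F x + fin (v - a) = fin v
    rw [ha, fin_add_fin, add_sub_cancel]

end Extended

/-! ### Cones, dual cones and weak* compactness -/

section Cones

variable {V : Type u} [AddCommGroup V] [Module ℝ V] [TopologicalSpace V]

theorem scal_fin (φ : StrongDual ℝ V) (a : V) : scal φ (fin a) = ((φ a : ℝ) : EReal) := rfl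

theorem scal_negInf (φ : StrongDual ℝ V) : scal φ negInf = ⊥ := rfl

theorem zero_mem_dualCone (K : Set V) : (0 : StrongDual ℝ V) ∈ dualCone K := fun _ _ => le_rfl

theorem smul_mem_dualCone [ContinuousConstSMul ℝ V] {K : Set V} {φ : StrongDual ℝ V}
    (hφ : φ ∈ dualCone K) {t : ℝ} (ht : 0 ≤ t) : t • φ ∈ dualCone K :=
  fun y hy => mul_nonneg ht (hφ y hy)

theorem mul_le_scal_smul {φ : StrongDual ℝ V} {g : Ext V} {d t : ℝ} (ht : 0 ≤ t)
    (h : (d : EReal) ≤ scal φ g) : ((t * d : ℝ) : EReal) ≤ scal (t • φ) g := by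
  rcases ext_cases g with rfl | rfl | ⟨a, rfl⟩
  · rw [scal_negInf, le_bot_iff] at h
    exact absurd h (EReal.coe_ne_bot d)
  · exact le_top
  · rw [scal_fin, EReal.coe_le_coe_iff] at h ⊢
    exact mul_le_mul_of_nonneg_left h ht

/-- The convention is that the zero functional still sends `+∞` to `+∞`, not to `0`. -/
theorem zero_le_scal_zero {g : Ext V} (hg : g ≠ negInf) :
    ((0 : ℝ) : EReal) ≤ scal (0 : StrongDual ℝ V) g := by
  rcases ext_cases g with rfl | rfl | ⟨a, rfl⟩
  · exact absurd rfl hg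
  · exact le_top
  · exact le_rfl

theorem exists_pos_add_smul_mem [IsTopologicalAddGroup V] [ContinuousSMul ℝ V] {s : Set V}
    {a : V} (ha : a ∈ interior s) (v : V) :
    ∃ t : ℝ, 0 < t ∧ a + t • v ∈ s := by
  have hc : Tendsto (fun t : ℝ => a + t • v) (𝓝 0) (𝓝 a) := by
    have : Continuous fun t : ℝ => a + t • v := by fun_prop
    simpa using this.tendsto 0
  have h := (hc.eventually (mem_interior_iff_mem_nhds.1 ha)).filter_mono
    (nhdsWithin_le_nhds (s := Ioi 0))
  obtain ⟨t, ht, ht'⟩ := (h.and self_mem_nhdsWithin).exists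
  exact ⟨t, ht', ht⟩

theorem pos_of_mem_interior [IsTopologicalAddGroup V] [ContinuousSMul ℝ V] {K : Set V}
    {φ : StrongDual ℝ V} (hφ : φ ∈ dualCone K) (h0 : φ ≠ 0) {k : V} (hk : k ∈ interior K) :
    0 < φ k := by
  obtain ⟨v, hv⟩ : ∃ v, φ v < 0 := by
    by_contra! h
    refine h0 (ContinuousLinearMap.ext fun v => le_antisymm ?_ (h v))
    have := h (-v)
    rw [map_neg] at this
    simpa using this
  obtain ⟨t, ht, hm⟩ := exists_pos_add_smul_mem hk v
  have h1 := hφ _ hm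
  rw [map_add, map_smul, smul_eq_mul] at h1
  have := mul_neg_of_pos_of_neg ht hv
  linarith

theorem interior_add_mem [IsTopologicalAddGroup V] (K : ConvexCone ℝ V) {a b : V}
    (ha : a ∈ interior (K : Set V)) (hb : b ∈ K) : a + b ∈ interior (K : Set V) := by
  refine interior_maximal ?_ (isOpen_interior.add_right (t := (K : Set V))) (add_mem_add ha hb)
  rintro _ ⟨a, ha, b, hb, rfl⟩
  exact K.add_mem (interior_subset ha) hb

theorem smul_mem_interior [ContinuousSMul ℝ V] (K : ConvexCone ℝ V) {a : V}
    (ha : a ∈ interior (K : Set V)) {t : ℝ} (ht : 0 < t) : t • a ∈ interior (K : Set V) := by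
  refine interior_maximal ?_ (isOpen_interior.smul₀ ht.ne') (smul_mem_smul_set ha)
  rintro _ ⟨a, ha, rfl⟩
  exact K.smul_mem ht (interior_subset ha)

theorem zero_notMem_interior [IsTopologicalAddGroup V] [ContinuousSMul ℝ V] (K : ConvexCone ℝ V)
    (hK : (K : Set V) ≠ univ) :
    (0 : V) ∉ interior (K : Set V) := by
  refine fun h => hK (eq_univ_of_forall fun v => ?_)
  obtain ⟨t, ht, hm⟩ := exists_pos_add_smul_mem h v
  rw [zero_add] at hm
  simpa [smul_smul, ht.ne'] using K.smul_mem (inv_pos.2 ht) hm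

theorem zero_mem_of_isClosed [ContinuousSMul ℝ V] (K : ConvexCone ℝ V) (hK : IsClosed (K : Set V))
    (hne : (K : Set V).Nonempty) : (0 : V) ∈ K := by
  obtain ⟨a, ha⟩ := hne
  have hc : Tendsto (fun t : ℝ => t • a) (𝓝[>] 0) (𝓝 0) := by
    have : Continuous fun t : ℝ => t • a := by fun_prop
    simpa using (this.tendsto 0).mono_left nhdsWithin_le_nhds
  exact hK.mem_of_tendsto hc (eventually_nhdsWithin_of_forall fun t ht => K.smul_mem ht ha)

theorem mem_dualCone_of_bddBelow (K : ConvexCone ℝ V) {φ : StrongDual ℝ V} {c : ℝ}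
    (h : ∀ a ∈ K, c ≤ φ a) : φ ∈ dualCone (K : Set V) := by
  intro a ha
  by_contra! hlt
  -- Scaling `a` by this factor gives `φ` the value `-(|c| + 1)`, which is below `c`.
  have ht : 0 < (|c| + 1) / -φ a := div_pos (by positivity) (neg_pos.2 hlt)
  have h1 := h _ (K.smul_mem ht ha)
  rw [map_smul, smul_eq_mul, div_mul_eq_mul_div, div_neg, mul_div_assoc, div_self hlt.ne,
    mul_one] at h1
  linarith [neg_abs_le c]

/-- The bipolar theorem: a point outside a closed convex cone is strictly separated from it, and the
separating functional is, up to sign, in the dual cone. -/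
theorem mem_of_forall_dualCone_nonneg [IsTopologicalAddGroup V] [ContinuousSMul ℝ V]
    [LocallyConvexSpace ℝ V] (S : ConvexCone ℝ V)
    (hS : IsClosed (S : Set V)) (hne : (S : Set V).Nonempty) {a : V}
    (h : ∀ φ ∈ dualCone (S : Set V), 0 ≤ φ a) : a ∈ S := by
  by_contra hna
  obtain ⟨f, c, hf, hfa⟩ := geometric_hahn_banach_closed_point S.convex hS hna
  have hc : 0 < c := by simpa using hf 0 (zero_mem_of_isClosed S hS hne)
  have hm : -f ∈ dualCone (S : Set V) := mem_dualCone_of_bddBelow S (c := -c) fun a ha => by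
    simpa using (hf a ha).le
  have := h _ hm
  rw [neg_apply] at this
  linarith

/-- The elements of `S⁺` taking values at most one at an interior point of `S` form a weak*
compact set. -/
theorem isCompact_dualCone_inter_le {Z : Type u} [NormedAddCommGroup Z] [NormedSpace ℝ Z]
    {S : Set Z} {s : Z} (hs : s ∈ interior S) :
    IsCompact {w : WeakDual ℝ Z | WeakDual.toStrongDual w ∈ dualCone S ∧ w s ≤ 1} := by
  -- On this neighbourhood `|w z| ≤ w s ≤ 1`, so the set lies in its polar and Banach–Alaoglu
  -- applies.
  have hN : {z : Z | s - z ∈ S ∧ s + z ∈ S} ∈ 𝓝 (0 : Z) := by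
    have h1 : Tendsto (fun z : Z => s - z) (𝓝 0) (𝓝 s) := by
      have : Continuous fun z : Z => s - z := by fun_prop
      simpa using this.tendsto 0
    have h2 : Tendsto (fun z : Z => s + z) (𝓝 0) (𝓝 s) := by
      have : Continuous fun z : Z => s + z := by fun_prop
      simpa using this.tendsto 0
    have h := mem_interior_iff_mem_nhds.1 hs
    exact inter_mem (h1 h) (h2 h)
  refine (WeakDual.isCompact_polar ℝ hN).of_isClosed_subset ?_ ?_
  · have hd : {w : WeakDual ℝ Z | WeakDual.toStrongDual w ∈ dualCone S ∧ w s ≤ 1} =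
        (⋂ z ∈ S, {w : WeakDual ℝ Z | 0 ≤ w z}) ∩ {w | w s ≤ 1} := by
      ext w
      simp only [mem_inter_iff, mem_iInter, mem_ofPred_eq]
      rfl
    rw [hd]
    exact (isClosed_biInter fun z _ =>
      isClosed_le continuous_const (WeakDual.eval_continuous z)).inter
        (isClosed_le (WeakDual.eval_continuous s) continuous_const)
  · rintro w ⟨hw, hws⟩ z ⟨h1, h2⟩
    have h1 : 0 ≤ w (s - z) := hw _ h1
    have h2 : 0 ≤ w (s + z) := hw _ h2
    rw [map_sub] at h1
    rw [map_add] at h2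
    change |w z| ≤ 1
    exact abs_le.2 ⟨by linarith, by linarith⟩

end Cones

/-! ### Scalar robust duality -/

section Duality

variable {X : Type*} [AddCommGroup X] [Module ℝ X]
  {Z : Type*} [NormedAddCommGroup Z] [NormedSpace ℝ Z] {U : Type*}

/-- If no approximate multiplier exists, separation gives weights on the `x i` whose convex
combination is feasible but has a negative value of `p`. -/
theorem exists_multiplier_of_finite [Nonempty U] (S : ConvexCone ℝ Z)
    (hSclosed : IsClosed (S : Set Z)) (hSne : (S : Set Z).Nonempty) {D : Set X}
    {p : X → ℝ} {G : U → X → Ext Z}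
    (hG : ∀ u x, G u x ≠ negInf) (hGconv : ∀ u, Convex ℝ (epi (S : Set Z) (G u)))
    (hp : ConvexOn ℝ D p)
    (hconc : UniformlyConcave (S : Set Z) fun (x : ↥D) (u : U) => G u x)
    (hpos : ∀ x ∈ D, (∀ u, G u x ∈ finSet (-(S : Set Z))) → 0 ≤ p x)
    {I : Type*} [Finite I] (x : I → X) (hx : ∀ i, x i ∈ D) (ε : I → ℝ) (hε : ∀ i, 0 < ε i) :
    ∃ u, ∃ φ ∈ dualCone (S : Set Z), ∀ i, ((-ε i - p (x i) : ℝ) : EReal) ≤ scal φ (G u (x i)) := by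
  classical
  have := Fintype.ofFinite I
  by_contra! hno
  -- The vectors dominated by some Lagrangian `p + φ ∘ G_u` at the sample points; uniform concavity
  -- makes this set convex.
  let H : Set (I → ℝ) := {r | ∃ u, ∃ φ ∈ dualCone (S : Set Z),
    ∀ i, ((r i - p (x i) : ℝ) : EReal) ≤ scal φ (G u (x i))}
  have hHconv : Convex ℝ H := by
    rintro r ⟨u₁, φ₁, h₁, hr⟩ r' ⟨u₂, φ₂, h₂, hr'⟩ a b ha hb hab
    obtain ⟨φ, hφ, u, h⟩ := hconc _ (smul_mem_dualCone h₁ ha) _ (smul_mem_dualCone h₂ hb) u₁ u₂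
    refine ⟨u, φ, hφ, fun i => le_trans ?_ (h ⟨x i, hx i⟩)⟩
    refine le_trans ?_ (add_le_add (mul_le_scal_smul ha (hr i)) (mul_le_scal_smul hb (hr' i)))
    rw [← EReal.coe_add, EReal.coe_le_coe_iff]
    simp only [Pi.add_apply, Pi.smul_apply, smul_eq_mul]
    have : p (x i) = a * p (x i) + b * p (x i) := by rw [← add_mul, hab, one_mul]
    linarith
  -- The tolerances put the origin inside this open orthant, which makes the separating constant `c`
  -- strictly positive.
  let O : Set (I → ℝ) := univ.pi fun i => Ioi (-ε i)
  have hOo : IsOpen O := isOpen_set_pi finite_univ fun i _ => isOpen_Ioi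
  have hOc : Convex ℝ O := convex_pi fun i _ => convex_Ioi _
  have hdisj : Disjoint O H := by
    rw [Set.disjoint_left]
    rintro r hr ⟨u, φ, hφ, h⟩
    obtain ⟨i, hi⟩ := hno u φ hφ
    refine absurd (h i) (not_le.2 (hi.trans ?_))
    rw [EReal.coe_lt_coe_iff]
    have := hr i (mem_univ i)
    rw [mem_Ioi] at this
    linarith
  obtain ⟨f, c, hfO, hfH⟩ := geometric_hahn_banach_open hOc hOo hHconv hdisj
  have hc : 0 < c := by
    simpa using hfO 0 fun i _ => neg_lt_zero.2 (hε i)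
  let l : I → ℝ := fun i => -f (Pi.single i 1)
  have hfl : ∀ r : I → ℝ, f r = -∑ i, l i * r i := by
    intro r
    have hr : r = ∑ i, r i • (Pi.single i 1 : I → ℝ) := by
      ext j
      simp [Finset.sum_apply, Pi.single_apply]
    conv_lhs => rw [hr, map_sum]
    rw [← Finset.sum_neg_distrib]
    refine Finset.sum_congr rfl fun i _ => ?_
    rw [map_smul, smul_eq_mul]
    simp only [l]
    ring
  have hl : ∀ i, 0 ≤ l i := by
    intro i
    by_contra! hlt
    have hlt : 0 < f (Pi.single i 1) := by simpa [l] using hlt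
    -- This nonnegative multiple of a basis vector stays in `O`, yet `f` takes the value `c` there.
    have h1 := hfO ((c / f (Pi.single i 1)) • Pi.single i 1) fun j _ => by
      have : (0 : ℝ) ≤ (Pi.single i 1 : I → ℝ) j := by
        rw [Pi.single_apply]; split_ifs <;> norm_num
      exact lt_of_lt_of_le (neg_lt_zero.2 (hε j)) (mul_nonneg (div_pos hc hlt).le this)
    rw [map_smul, smul_eq_mul, div_mul_cancel₀ _ hlt.ne'] at h1
    exact lt_irrefl _ h1
  have hH : ∀ r ∈ H, ∑ i, l i * r i < 0 := by
    intro r hr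
    have := hfH r hr
    rw [hfl] at this
    linarith
  have hbase : ∑ i, l i * p (x i) < 0 := by
    obtain ⟨u⟩ := ‹Nonempty U›
    exact hH _ ⟨u, 0, zero_mem_dualCone _, fun i => by
      rw [sub_self]; exact zero_le_scal_zero (hG u _)⟩
  -- homogeneity in the multiplier removes the constant term
  have hhom : ∀ u, ∀ φ ∈ dualCone (S : Set Z), ∀ d : I → ℝ,
      (∀ i, (d i : EReal) ≤ scal φ (G u (x i))) → ∑ i, l i * d i ≤ 0 := by
    intro u φ hφ d hd
    by_contra! hlt
    set e := ∑ i, l i * d i with he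
    set b := ∑ i, l i * p (x i) with hb
    have ht : 0 ≤ -b / e := div_nonneg (by linarith) hlt.le
    have := hH (fun i => p (x i) + (-b / e) * d i) ⟨u, (-b / e) • φ, smul_mem_dualCone hφ ht,
      fun i => by rw [add_sub_cancel_left]; exact mul_le_scal_smul ht (hd i)⟩
    have h2 : ∑ i, l i * (p (x i) + (-b / e) * d i) = b + (-b / e) * e := by
      rw [he, hb, Finset.mul_sum, ← Finset.sum_add_distrib]
      exact Finset.sum_congr rfl fun i _ => by ring
    rw [h2, div_mul_cancel₀ _ hlt.ne'] at this
    linarith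
  have hsum : 0 < ∑ i, l i := by
    refine lt_of_le_of_ne (Finset.sum_nonneg fun i _ => hl i) fun h => ?_
    have h0 := (Finset.sum_eq_zero_iff_of_nonneg fun i _ => hl i).1 h.symm
    refine hbase.ne (Finset.sum_eq_zero fun i hi => ?_)
    rw [h0 i hi, zero_mul]
  let m : I → ℝ := fun i => l i / ∑ j, l j
  have hm : ∀ i, 0 ≤ m i := fun i => div_nonneg (hl i) hsum.le
  have hm1 : ∑ i, m i = 1 := by
    rw [← Finset.sum_div, div_self hsum.ne']
  have hJ : ∑ i with m i ≠ 0, m i = 1 := by rw [Finset.sum_filter_ne_zero, hm1]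
  have hxD : ∑ i, m i • x i ∈ D := hp.1.sum_mem (fun i _ => hm i) hm1 fun i _ => hx i
  have hA : ∀ u, G u (∑ i, m i • x i) ∈ finSet (-(S : Set Z)) := by
    intro u
    -- Where `G u` is infinite, the zero multiplier already dominates the `i`-th unit vector, so
    -- `hhom` forces the weight to vanish; `z i = 0` is then a harmless default.
    have hfin : ∀ i, ∃ z, G u (x i) = fin z ∨ m i = 0 ∧ G u (x i) = posInf := by
      intro i
      rcases ext_cases (G u (x i)) with h | h | ⟨z, h⟩
      · exact absurd h (hG u _)
      · refine ⟨0, Or.inr ⟨?_, h⟩⟩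
        have := hhom u 0 (zero_mem_dualCone _) (Pi.single i 1) fun j => by
          rcases eq_or_ne j i with rfl | hji
          · rw [h]; exact le_top
          · rw [Pi.single_eq_of_ne hji]; exact zero_le_scal_zero (hG u _)
        rw [Finset.sum_eq_single i (fun j _ hji => by rw [Pi.single_eq_of_ne hji, mul_zero])
          (fun h => absurd (Finset.mem_univ i) h), Pi.single_eq_same, mul_one] at this
        simp only [m]
        rw [le_antisymm this (hl i), zero_div]
      · exact ⟨z, Or.inl h⟩
    choose z hz using hfin
    have hepi : ∑ i with m i ≠ 0, m i • (x i, z i) ∈ epi (S : Set Z) (G u) := by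
      refine (hGconv u).sum_mem (fun i _ => hm i) hJ fun i hi => mem_epi_iff.2 ⟨z i, ?_, ?_⟩
      · exact (hz i).resolve_right fun h => (Finset.mem_filter.1 hi).2 h.1
      · rw [sub_self]; exact zero_mem_of_isClosed S hSclosed hSne
    have hsplit : ∑ i with m i ≠ 0, m i • (x i, z i) = (∑ i, m i • x i, ∑ i, m i • z i) := by
      rw [Finset.sum_filter_of_ne (p := fun i => m i ≠ 0) (f := fun i => m i • (x i, z i))
        fun i _ h hi => h (by rw [hi, zero_smul])]
      ext <;> simp [Prod.fst_sum, Prod.snd_sum]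
    rw [hsplit] at hepi
    obtain ⟨a, ha, hs⟩ := mem_epi_iff.1 hepi
    rw [ha, fin_mem_finSet, Set.mem_neg]
    -- By `hhom`, every `φ ∈ S⁺` is nonpositive on the weighted sum; the bipolar theorem converts
    -- this into membership in `-S`.
    have hneg : -∑ i, m i • z i ∈ S := by
      refine mem_of_forall_dualCone_nonneg S hSclosed hSne fun φ hφ => ?_
      have := hhom u φ hφ (fun i => φ (z i)) fun i => by
        rcases hz i with h | ⟨-, h⟩
        · rw [h, scal_fin]
        · rw [h]; exact le_top
      have h2 : φ (∑ i, m i • z i) = (∑ j, l j)⁻¹ * ∑ i, l i * φ (z i) := by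
        rw [map_sum, Finset.mul_sum]
        refine Finset.sum_congr rfl fun i _ => ?_
        rw [map_smul, smul_eq_mul]
        simp only [m]
        ring
      rw [map_neg, h2]
      exact neg_nonneg.2 (mul_nonpos_of_nonneg_of_nonpos (inv_pos.2 hsum).le this)
    have h3 := S.add_mem hneg hs
    rwa [neg_add_eq_sub, sub_sub_cancel_left] at h3
  have h1 := hpos _ hxD hA
  have h2 := hp.map_sum_le (t := Finset.univ) (fun i _ => hm i) hm1 fun i _ => hx i
  have h3 : ∑ i, m i • p (x i) = (∑ j, l j)⁻¹ * ∑ i, l i * p (x i) := by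
    rw [Finset.mul_sum]
    exact Finset.sum_congr rfl fun i _ => by simp only [m, smul_eq_mul]; ring
  rw [h3] at h2
  have := mul_neg_of_pos_of_neg (inv_pos.2 hsum) hbase
  linarith

/-- Since `S⁺` is weak* closed, closedness relative to `S⁺ × U × ℝ` is closedness outright. -/
theorem isClosed_setOf_le_scal [TopologicalSpace U] {S : Set Z} {g : U → Ext Z}
    (hg : UniformlyUSC S g) :
    IsClosed {q : WeakDual ℝ Z × U × ℝ | WeakDual.toStrongDual q.1 ∈ dualCone S ∧
      (q.2.2 : EReal) ≤ scal (WeakDual.toStrongDual q.1) (g q.2.1)} := by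
  refine isClosed_of_closure_subset fun q hq => ?_
  have hd : IsClosed {q : WeakDual ℝ Z × U × ℝ | WeakDual.toStrongDual q.1 ∈ dualCone S} := by
    have : {q : WeakDual ℝ Z × U × ℝ | WeakDual.toStrongDual q.1 ∈ dualCone S} =
        ⋂ z ∈ S, {q | 0 ≤ q.1 z} := by
      ext q
      simp only [mem_iInter, mem_ofPred_eq]
      rfl
    rw [this]
    exact isClosed_biInter fun z _ =>
      isClosed_le continuous_const ((WeakDual.eval_continuous z).comp continuous_fst)
  have hqS := closure_minimal (fun q h => h.1) hd hq
  exact ⟨hqS, (uniformlyUSC_iff S g).1 hg q hq hqS⟩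

theorem exists_multiplier [TopologicalSpace U] [CompactSpace U] [Nonempty U]
    (S : ConvexCone ℝ Z) (hSclosed : IsClosed (S : Set Z))
    {D : Set X} {p : X → ℝ} {G : U → X → Ext Z}
    (hG : ∀ u x, G u x ≠ negInf) (hGconv : ∀ u, Convex ℝ (epi (S : Set Z) (G u)))
    (hp : ConvexOn ℝ D p)
    (hconc : UniformlyConcave (S : Set Z) fun (x : ↥D) (u : U) => G u x)
    (husc : ∀ x ∈ D, UniformlyUSC (S : Set Z) fun u : U => G u x)
    (hslater : ∀ u, ∃ x ∈ D, G u x ∈ finSet (-interior (S : Set Z)))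
    (hpos : ∀ x ∈ D, (∀ u, G u x ∈ finSet (-(S : Set Z))) → 0 ≤ p x) :
    ∃ u, ∃ φ ∈ dualCone (S : Set Z), ∀ x ∈ D, ((-p x : ℝ) : EReal) ≤ scal φ (G u x) := by
  obtain ⟨s, hs⟩ : (interior (S : Set Z)).Nonempty := by
    obtain ⟨u⟩ := ‹Nonempty U›
    obtain ⟨x, _, a, ha, _⟩ := hslater u
    exact ⟨-a, ha⟩
  -- The third coordinate weights `p`. The normalisation `q.1 s + q.2.2 = 1` gives compactness and
  -- excludes the trivial pair.
  let P : Set (WeakDual ℝ Z × U × ℝ) :=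
    ({w : WeakDual ℝ Z | WeakDual.toStrongDual w ∈ dualCone (S : Set Z) ∧ w s ≤ 1} ×ˢ
      (univ ×ˢ Icc 0 1)) ∩ {q | q.1 s + q.2.2 = 1}
  have hP : IsCompact P :=
    ((isCompact_dualCone_inter_le hs).prod (isCompact_univ.prod isCompact_Icc)).inter_right
      (isClosed_eq (((WeakDual.eval_continuous s).comp continuous_fst).add
        (continuous_snd.comp continuous_snd)) continuous_const)
  let Λ : ↥D × {ε : ℝ // 0 < ε} → Set (WeakDual ℝ Z × U × ℝ) := fun i =>
    {q | WeakDual.toStrongDual q.1 ∈ dualCone (S : Set Z) ∧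
      ((-i.2.1 - q.2.2 * p i.1 : ℝ) : EReal) ≤ scal (WeakDual.toStrongDual q.1) (G q.2.1 i.1)}
  have hΛ : ∀ i, IsClosed (Λ i) := fun i =>
    (isClosed_setOf_le_scal (husc i.1 i.1.2)).preimage
      (f := fun q : WeakDual ℝ Z × U × ℝ => (q.1, q.2.1, -i.2.1 - q.2.2 * p i.1))
      (by fun_prop)
  obtain ⟨⟨w, u, t⟩, ⟨⟨⟨hw, hws⟩, -, ht, -⟩, hwt⟩, hq⟩ : (P ∩ ⋂ i, Λ i).Nonempty := by
    refine hP.inter_iInter_nonempty Λ hΛ fun I => ?_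
    obtain ⟨u, φ, hφ, h⟩ := exists_multiplier_of_finite S hSclosed ⟨s, interior_subset hs⟩ hG hGconv
      hp hconc hpos (fun i : I => (i.1.1 : X)) (fun i => i.1.1.2) (fun i => i.1.2.1)
      (fun i => i.1.2.2)
    have hφs : 0 ≤ φ s := hφ s (interior_subset hs)
    have hden : 0 < 1 + φ s := by linarith
    set t := (1 + φ s)⁻¹ with htdef
    have ht : 0 < t := inv_pos.2 hden
    have ht1 : t ≤ 1 := inv_le_one_of_one_le₀ (by linarith)
    have hsum : t * φ s + t = 1 := by
      rw [htdef]; field_simp; ring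
    have hmem := smul_mem_dualCone hφ ht.le
    refine ⟨(StrongDual.toWeakDual (t • φ), u, t), ⟨⟨⟨hmem, ?_⟩, mem_univ _, ht.le, ht1⟩, hsum⟩,
      mem_iInter₂.2 fun i hi => ⟨hmem, ?_⟩⟩
    · change t * φ s ≤ 1
      linarith
    -- Rescaling shrinks the tolerance to `t * ε`, which is at most `ε` because `t ≤ 1`.
    · refine le_trans ?_ (mul_le_scal_smul ht.le (h ⟨i, hi⟩))
      rw [EReal.coe_le_coe_iff]
      have := mul_le_mul_of_nonneg_right ht1 i.2.2.le
      dsimp only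
      linarith
  rw [mem_iInter] at hq
  set φ := WeakDual.toStrongDual w
  have hall : ∀ x ∈ D, ((-(t * p x) : ℝ) : EReal) ≤ scal φ (G u x) := by
    intro x hx
    rcases ext_cases (G u x) with h | h | ⟨a, h⟩
    · exact absurd h (hG u x)
    · rw [h]; exact le_top
    · rw [h, scal_fin, EReal.coe_le_coe_iff]
      refine le_of_forall_pos_sub_le fun ε hε => ?_
      have h1 := (hq (⟨x, hx⟩, ⟨ε, hε⟩)).2
      dsimp only at h1
      rw [h, scal_fin, EReal.coe_le_coe_iff] at h1
      have : WeakDual.toStrongDual w a = φ a := rfl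
      linarith
  have hwt : φ s + t = 1 := hwt
  -- If `t = 0`, the normalisation makes `φ` nonzero, and `φ ∘ G_u ≥ 0` on `D` contradicts strict
  -- negativity at the Slater point of `u`.
  have htpos : 0 < t := by
    refine lt_of_le_of_ne ht fun h0 => ?_
    have hφ0 : φ ≠ 0 := by
      rintro h
      rw [h, ← h0] at hwt
      simp at hwt
    obtain ⟨x, hx, a, ha, hax⟩ := hslater u
    have h1 := hall x hx
    rw [← hax, scal_fin, EReal.coe_le_coe_iff, ← h0, zero_mul, neg_zero] at h1
    have h2 := pos_of_mem_interior hw hφ0 ha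
    rw [map_neg] at h2
    exact absurd h1 (not_le.2 (neg_pos.1 h2))
  refine ⟨u, t⁻¹ • φ, smul_mem_dualCone hw (inv_pos.2 htpos).le, fun x hx => ?_⟩
  have h := mul_le_scal_smul (inv_pos.2 htpos).le (hall x hx)
  rwa [mul_neg, inv_mul_cancel_left₀ htpos.ne'] at h

end Duality

/-! ### From scalar to vector multipliers -/

section Farkas

variable {X : Type*} [AddCommGroup X] [Module ℝ X] [TopologicalSpace X]
  {Y : Type*} [AddCommGroup Y] [Module ℝ Y] [TopologicalSpace Y]
  {Z : Type*} [AddCommGroup Z] [Module ℝ Z] [TopologicalSpace Z]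
  {U : Type*}

theorem weakPosMultiplier_implies (K : ConvexCone ℝ Y) {S : Set Z} {C : Set X} {F : X → Ext Y}
    {G : U → X → Ext Z} {L : X →L[ℝ] Y} {y : Y}
    (h : HasWeakPosMultiplier (K : Set Y) S C F G L y) :
    RobustImplication (K : Set Y) S C F G L y := by
  obtain ⟨u, T, -, hT⟩ := h
  rintro x hx hGx ⟨k, hk, hk'⟩
  obtain ⟨s, hs, hs'⟩ := hGx u
  obtain ⟨a, b, ha, hb, hab⟩ := add_eq_fin hk'.symm
  refine hT x hx ?_
  rw [hb, ← hs', extMap_fin, fin_add_fin, fin_add_fin, fin_mem_finSet]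
  refine ⟨-T (-s), Set.neg_mem_neg.2 ⟨-s, hs, rfl⟩, -k, hk, ?_⟩
  cases fin_injective ha
  change -T (-s) - -k = b + T s + (-L x + y)
  rw [← hab, map_neg]
  abel

theorem HasPosMultiplier.weak [IsTopologicalAddGroup Y] [ContinuousSMul ℝ Y]
    (K : ConvexCone ℝ Y) (hK : (K : Set Y) ≠ univ)
    {S : Set Z} {C : Set X} {F : X → Ext Y} {G : U → X → Ext Z} {L : X →L[ℝ] Y} {y : Y}
    (h : HasPosMultiplier (K : Set Y) S C F G L y) :
    HasWeakPosMultiplier (K : Set Y) S C F G L y := by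
  obtain ⟨u, T, hTK, hT⟩ := h
  refine ⟨u, T, ?_, fun x hx hmem => hT x hx ?_⟩
  · refine eq_empty_of_forall_notMem fun a ha => zero_notMem_interior K hK ?_
    simpa using interior_add_mem K ha.2 (hTK ha.1)
  · obtain ⟨a, ⟨b, hb, c, hc, rfl⟩, ha⟩ := hmem
    refine ⟨_, ?_, ha⟩
    have := interior_add_mem K hc (hTK hb)
    rw [Set.mem_neg]
    convert this using 1
    change -(b - c) = c + -b
    abel

theorem HasScalarMultiplier.pos [ContinuousSMul ℝ Y] (K : ConvexCone ℝ Y) (h0 : (0 : Y) ∈ K)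
    {S : Set Z} {C : Set X} {F : X → Ext Y} {G : U → X → Ext Z} {k : Y} (hk : k ∈ K)
    {L : X →L[ℝ] Y} {y : Y} (h : HasScalarMultiplier (K : Set Y) S C F G k L y) :
    HasPosMultiplier (K : Set Y) S C F G L y := by
  obtain ⟨u, φ, hφ, h⟩ := h
  refine ⟨u, φ.smulRight k, ?_, h⟩
  rintro _ ⟨s, hs, rfl⟩
  change φ s • k ∈ K
  rcases (hφ s hs).eq_or_lt with h | h
  · rw [← h, zero_smul]; exact h0
  · exact K.smul_mem h hk

/-- The values of `F - L + y` at feasible points are separated from `-int K` by a functional of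
`K⁺ \ {0}`. -/
theorem RobustImplication.exists_dualCone [IsTopologicalAddGroup Y] [ContinuousSMul ℝ Y]
    (K : ConvexCone ℝ Y) (hK0 : (0 : Y) ∈ K)
    (hKint : (interior (K : Set Y)).Nonempty) {Z : Type*} [AddCommGroup Z] [Module ℝ Z]
    (S : ConvexCone ℝ Z) {C : Set X}
    {F : X → Ext Y} {G : U → X → Ext Z} (hF : IsProper F)
    (hfeas : (feasible (S : Set Z) C G ∩ dom F).Nonempty)
    (hFconv : Convex ℝ (epi (K : Set Y) F)) (hGconv : ∀ u, Convex ℝ (epi (S : Set Z) (G u)))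
    (hCconv : Convex ℝ C) {L : X →L[ℝ] Y} {y : Y}
    (h : RobustImplication (K : Set Y) (S : Set Z) C F G L y) :
    ∃ ψ ∈ dualCone (K : Set Y), ψ ≠ 0 ∧
      ∀ x ∈ C, (∀ u, G u x ∈ finSet (-(S : Set Z))) → ∀ a, F x = fin a → 0 ≤ ψ (a - L x + y) := by
  -- This is the union of `F x - L x + y + K` over feasible `x`. Adding `K`, and writing feasibility
  -- as `(x, 0) ∈ epi S (G u)`, lets convexity be read off the epigraphs.
  let E : Set Y := {v | ∃ x ∈ C, (∀ u, (x, (0 : Z)) ∈ epi (S : Set Z) (G u)) ∧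
    (x, v + L x - y) ∈ epi (K : Set Y) F}
  have hGx : ∀ u x, (x, (0 : Z)) ∈ epi (S : Set Z) (G u) ↔ G u x ∈ finSet (-(S : Set Z)) := by
    intro u x
    rw [mem_epi_iff]
    constructor
    · rintro ⟨a, ha, hs⟩
      rw [ha, fin_mem_finSet, Set.mem_neg]
      rwa [zero_sub] at hs
    · rintro ⟨a, ha, hax⟩
      exact ⟨a, hax.symm, by rwa [zero_sub]⟩
  have hE : Convex ℝ E := by
    rintro v ⟨x, hx, hxG, hxF⟩ v' ⟨x', hx', hxG', hxF'⟩ a b ha hb hab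
    refine ⟨a • x + b • x', hCconv hx hx' ha hb hab, fun u => ?_, ?_⟩
    · simpa using hGconv u (hxG u) (hxG' u) ha hb hab
    · have := hFconv hxF hxF' ha hb hab
      convert this using 1
      refine Prod.ext rfl ?_
      simp only [Prod.snd_add, Prod.smul_snd, map_add, map_smul, smul_sub, smul_add]
      have hy : y = a • y + b • y := by rw [← add_smul, hab, one_smul]
      conv_lhs => rw [hy]
      abel
  have hEmem : ∀ x ∈ C, (∀ u, G u x ∈ finSet (-(S : Set Z))) → ∀ a, F x = fin a →
      a - L x + y ∈ E := by
    intro x hx hxG a ha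
    refine ⟨x, hx, fun u => (hGx u x).2 (hxG u), mem_epi_iff.2 ⟨a, ha, ?_⟩⟩
    have h0 : a - L x + y + L x - y - a = 0 := by abel
    rw [h0]
    exact hK0
  have hdisj : Disjoint (-interior (K : Set Y)) E := by
    rw [Set.disjoint_left]
    rintro v hv ⟨x, hx, hxG, hxF⟩
    obtain ⟨a, ha, hk⟩ := mem_epi_iff.1 hxF
    refine h x hx (fun u => (hGx u x).1 (hxG u)) ?_
    rw [ha, fin_add_fin, fin_mem_finSet, Set.mem_neg]
    convert interior_add_mem K hv hk using 1
    abel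
  obtain ⟨f, c, hfK, hfE⟩ := geometric_hahn_banach_open (K.convex.interior.neg)
    isOpen_interior.neg hE hdisj
  obtain ⟨k₀, hk₀⟩ := hKint
  have hlt : ∀ k ∈ interior (K : Set Y), -c < f k := by
    intro k hk
    have := hfK (-k) (by rwa [Set.neg_mem_neg])
    rw [map_neg] at this
    linarith
  -- Points `t • k₀` of `int K` tend to `0` as `t` decreases to `0`, and `f > -c` on `int K`.
  have hc : 0 ≤ c := by
    have hlim : Tendsto (fun t : ℝ => t * f k₀) (𝓝[>] 0) (𝓝 0) := by
      have : Continuous fun t : ℝ => t * f k₀ := by fun_prop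
      simpa using (this.tendsto 0).mono_left nhdsWithin_le_nhds
    have := ge_of_tendsto hlim (b := -c) (eventually_nhdsWithin_of_forall fun t ht => by
      simpa using (hlt _ (smul_mem_interior K hk₀ ht)).le)
    linarith
  have hfd : f ∈ dualCone (K : Set Y) := by
    refine mem_dualCone_of_bddBelow K (c := -c - f k₀) fun a ha => ?_
    have := hlt _ (interior_add_mem K hk₀ ha)
    rw [map_add] at this
    linarith
  refine ⟨f, hfd, ?_, fun x hx hxG a ha => hc.trans (hfE _ (hEmem x hx hxG a ha))⟩
  rintro rfl
  obtain ⟨x, ⟨hxC, hxA⟩, hxF⟩ := hfeas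
  obtain ⟨a, ha⟩ := hF.eq_fin hxF
  have h1 := hfE _ (hEmem x hxC (fun u => mem_iInter.1 hxA u) a ha)
  have h2 := hlt k₀ hk₀
  simp only [zero_apply] at h1 h2
  linarith

theorem convexOn_dualCone_comp (K : ConvexCone ℝ Y) (hK0 : (0 : Y) ∈ K) {C : Set X}
    {F : X → Ext Y} (hFconv : Convex ℝ (epi (K : Set Y) F)) (hCconv : Convex ℝ C)
    {f : X → Y} (hf : ∀ x ∈ dom F, F x = fin (f x)) {ψ : StrongDual ℝ Y}
    (hψ : ψ ∈ dualCone (K : Set Y)) (L : X →L[ℝ] Y) (y : Y) :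
    ConvexOn ℝ (C ∩ dom F) fun x => ψ (f x - L x + y) := by
  have key : ∀ x ∈ dom F, ∀ x' ∈ dom F, ∀ a b : ℝ, 0 ≤ a → 0 ≤ b → a + b = 1 →
      a • x + b • x' ∈ dom F ∧ a • f x + b • f x' - f (a • x + b • x') ∈ K := by
    intro x hx x' hx' a b ha hb hab
    have hmem : ∀ x ∈ dom F, (x, f x) ∈ epi (K : Set Y) F := fun x hx =>
      mem_epi_iff.2 ⟨f x, hf x hx, by rwa [sub_self]⟩
    obtain ⟨v, hv, hk⟩ := mem_epi_iff.1 (hFconv (hmem x hx) (hmem x' hx') ha hb hab)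
    have hd := mem_dom_of_eq_fin hv
    have hv' : f (a • x + b • x') = v := fin_injective ((hf _ hd).symm.trans hv)
    exact ⟨hd, by rw [hv']; exact hk⟩
  refine ⟨fun x hx x' hx' a b ha hb hab => ⟨hCconv hx.1 hx'.1 ha hb hab,
    (key x hx.2 x' hx'.2 a b ha hb hab).1⟩, fun x hx x' hx' a b ha hb hab => ?_⟩
  have h := hψ _ (key x hx.2 x' hx'.2 a b ha hb hab).2
  have hy : ψ y = a * ψ y + b * ψ y := by rw [← add_mul, hab, one_mul]
  simp only [map_add, map_sub, map_smul, smul_eq_mul] at h ⊢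
  linarith

theorem RobustImplication.hasScalarMultiplier [IsTopologicalAddGroup Y] [ContinuousSMul ℝ Y]
    [TopologicalSpace U] [CompactSpace U] [Nonempty U]
    {Z : Type*} [NormedAddCommGroup Z] [NormedSpace ℝ Z]
    (K : ConvexCone ℝ Y) (hKclosed : IsClosed (K : Set Y))
    (S : ConvexCone ℝ Z) (hSclosed : IsClosed (S : Set Z))
    {C : Set X} {F : X → Ext Y} {G : U → X → Ext Z}
    (hF : IsProper F) (hG : ∀ u, IsProper (G u))
    (hfeas : (feasible (S : Set Z) C G ∩ dom F).Nonempty)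
    (hFconv : Convex ℝ (epi (K : Set Y) F)) (hGconv : ∀ u, Convex ℝ (epi (S : Set Z) (G u)))
    (hCconv : Convex ℝ C)
    (hconc : UniformlyConcave (S : Set Z) fun (x : ↥(C ∩ dom F)) (u : U) => G u x)
    (husc : ∀ x ∈ C ∩ dom F, UniformlyUSC (S : Set Z) fun u : U => G u x)
    (hslater : ∀ u, ∃ x ∈ C ∩ dom F, G u x ∈ finSet (-interior (S : Set Z)))
    {k : Y} (hk : k ∈ interior (K : Set Y)) {L : X →L[ℝ] Y} {y : Y}
    (h : RobustImplication (K : Set Y) (S : Set Z) C F G L y) :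
    HasScalarMultiplier (K : Set Y) (S : Set Z) C F G k L y := by
  have hK0 := zero_mem_of_isClosed K hKclosed ⟨k, interior_subset hk⟩
  obtain ⟨ψ, hψ, hψ0, hpos⟩ :=
    h.exists_dualCone K hK0 ⟨k, hk⟩ S hF hfeas hFconv hGconv hCconv
  have hfin : ∀ x, ∃ a, x ∈ dom F → F x = fin a := fun x => by
    by_cases hx : x ∈ dom F
    · obtain ⟨a, ha⟩ := hF.eq_fin hx
      exact ⟨a, fun _ => ha⟩
    · exact ⟨0, fun h => absurd h hx⟩
  choose f hf using hfin
  obtain ⟨u, φ, hφ, hmul⟩ := exists_multiplier S hSclosed (fun u x => (hG u).2 x) hGconv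
    (convexOn_dualCone_comp K hK0 hFconv hCconv hf hψ L y) hconc husc hslater
    fun x hx hxG => hpos x hx.1 hxG _ (hf x hx.2)
  have hψk := pos_of_mem_interior hψ hψ0 hk
  refine ⟨u, (ψ k)⁻¹ • φ, smul_mem_dualCone hφ (inv_pos.2 hψk).le, ?_⟩
  rintro x hx ⟨κ, hκ, hκ'⟩
  -- A sum lying in `-int K` is finite, hence so are its summands; points where `F` or `G u` is `+∞`
  -- need no inequality.
  obtain ⟨b, c, hb, hc, hbc⟩ := add_eq_fin hκ'.symm
  obtain ⟨a, d, ha, hd, had⟩ := add_eq_fin hb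
  obtain ⟨z, hz, hzd⟩ := extMap_eq_fin hd
  have hxF := mem_dom_of_eq_fin ha
  have hfa : f x = a := fin_injective ((hf x hxF).symm.trans ha)
  have h1 := hmul x ⟨hx, hxF⟩
  rw [hz, scal_fin, EReal.coe_le_coe_iff, hfa] at h1
  have h2 := pos_of_mem_interior hψ hψ0 hκ
  cases fin_injective hc
  rw [← hbc, ← had, ← hzd] at h2
  simp only [smul_apply, map_neg, map_add, map_sub, map_smul, smul_eq_mul] at h1 h2
  have h3 : (ψ k)⁻¹ * φ z * ψ k = φ z := by field_simp
  linarith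

end Farkas

end RobustFarkas

open RobustFarkas
theorem theorem5p6
    {X : Type*} [AddCommGroup X] [Module ℝ X] [TopologicalSpace X] [IsTopologicalAddGroup X]
    [ContinuousSMul ℝ X] [LocallyConvexSpace ℝ X] [T2Space X]
    {Y : Type*} [AddCommGroup Y] [Module ℝ Y] [TopologicalSpace Y] [IsTopologicalAddGroup Y]
    [ContinuousSMul ℝ Y] [LocallyConvexSpace ℝ Y] [T2Space Y]
    {Z : Type*} [NormedAddCommGroup Z] [NormedSpace ℝ Z]
    {U : Type*} [TopologicalSpace U] [CompactSpace U] [Nonempty U]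
    (K : ConvexCone ℝ Y) (hKclosed : IsClosed (K : Set Y))
    (hKint : (interior (K : Set Y)).Nonempty) (hKne : (K : Set Y) ≠ Set.univ)
    (S : ConvexCone ℝ Z) (hSclosed : IsClosed (S : Set Z)) (hSne : (S : Set Z).Nonempty)
    (C : Set X) (F : X → Ext Y) (G : U → X → Ext Z)
    (hF : IsProper F) (hG : ∀ u, IsProper (G u))
    (hfeas : (feasible (S : Set Z) C G ∩ dom F).Nonempty)
    -- (H0)
    (hFconv : Convex ℝ (epi (K : Set Y) F)) (hFlsc : PositivelyLSC (K : Set Y) F)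
    (hGconv : ∀ u, Convex ℝ (epi (S : Set Z) (G u)))
    (hGclosed : ∀ u, IsClosed (epi (S : Set Z) (G u)))
    (hCne : C.Nonempty) (hCclosed : IsClosed C) (hCconv : Convex ℝ C)
    -- (H1)
    (hH1 : UniformlyConcave (S : Set Z) fun (x : ↥(C ∩ dom F)) (u : U) => G u x)
    -- (H2)
    (hH2 : ∀ x ∈ C ∩ dom F, UniformlyUSC (S : Set Z) fun u : U => G u x)
    -- (C0)
    (hC0 : ∀ u, ∃ x ∈ C ∩ dom F, G u x ∈ finSet (-interior (S : Set Z)))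
    (𝒱 : Set (X →L[ℝ] Y)) (𝒲 : Set Y) :
    (∀ L ∈ 𝒱, ∀ y ∈ 𝒲,
      (RobustImplication (K : Set Y) (S : Set Z) C F G L y ↔
        HasPosMultiplier (K : Set Y) (S : Set Z) C F G L y)) ∧
    (∀ L ∈ 𝒱, ∀ y ∈ 𝒲,
      (RobustImplication (K : Set Y) (S : Set Z) C F G L y ↔
        HasWeakPosMultiplier (K : Set Y) (S : Set Z) C F G L y)) ∧
    (∀ k ∈ interior (K : Set Y), ∀ L ∈ 𝒱, ∀ y ∈ 𝒲,
      (RobustImplication (K : Set Y) (S : Set Z) C F G L y ↔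
        HasScalarMultiplier (K : Set Y) (S : Set Z) C F G k L y)) := by
  have hscal : ∀ k ∈ interior (K : Set Y), ∀ {L : X →L[ℝ] Y} {y : Y},
      RobustImplication (K : Set Y) (S : Set Z) C F G L y →
        HasScalarMultiplier (K : Set Y) (S : Set Z) C F G k L y := fun k hk _ _ h =>
    h.hasScalarMultiplier K hKclosed S hSclosed hF hG hfeas hFconv hGconv hCconv hH1 hH2 hC0 hk
  have hK0 := zero_mem_of_isClosed K hKclosed (hKint.mono interior_subset)
  obtain ⟨k₀, hk₀⟩ := hKint
  -- For (β) and (γ) the direction is immaterial, so any interior point `k₀` of `K` serves.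
  refine ⟨fun L _ y _ => ⟨fun h => ?_, fun h => ?_⟩, fun L _ y _ => ⟨fun h => ?_, fun h => ?_⟩,
    fun k hk L _ y _ => ⟨hscal k hk, fun h => ?_⟩⟩
  · exact (hscal k₀ hk₀ h).pos K hK0 (interior_subset hk₀)
  · exact weakPosMultiplier_implies K (h.weak K hKne)
  · exact ((hscal k₀ hk₀ h).pos K hK0 (interior_subset hk₀)).weak K hKne
  · exact weakPosMultiplier_implies K h
  · exact weakPosMultiplier_implies K ((h.pos K hK0 (interior_subset hk)).weak K hKne)
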